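/- An orientably regular map $\mathcal M$ (a connected map on an oriented surface whose orientation-preserving automorphism group $\mathrm{Aut}^+\mathcal M$ is transitive on arcs, i.e. directed edges) is described by its monodromy permutations of the arcs: $x$, rotating each arc to the next one around its initial vertex, $y$ with $y^2=1$, reversing each arc, and $z$ with $xyz=1$ (permutations composed from left to right), rotating arcs around faces; $\mathrm{Aut}^+\mathcal M$ is the group of permutations of the arcs commuting with $x$ and $y$. The map has type $\{p,q\}$ if $z$ has order $p$ and $x$ has order $q$, so that its faces are $p$-gons and its vertices have valency $q$. Isomorphisms of maps are orientation-preserving. For a group $G$, let $\mathcal O(G)$ be the graph whose vertices are the isomorphism classes of orientably regular maps $\mathcal M$ with $\mathrm{Aut}^+\mathcal M\cong G$, two distinct classes being adjacent if one is obtained from the other by the duality $D$, which replaces $(x,y)$ with $(z,y)$, or by a hole operation $H_j$, which replaces $(x,y)$ with $(x^j,y)$, where $j$ is an integer coprime to the valency. A Hurwitz map is an orientably regular map of type $\{3,7\}$ with finite group $\mathrm{Aut}^+\mathcal M$. **Theorem.** For each $m\in\mathbb N$ there exists $N'_m\in\mathbb N$ such that if $n\ge N'_m$ then $\mathcal O(\mathrm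 A_n)$, where $\mathrm A_n$ is the alternating group of degree $n$, has at least $m$ connected components containing Hurwitz maps. -/

import Mathlib

/-- A connected map on an oriented surface, given by its monodromy permutations: `rot` rotates each
arc (directed edge) to the next one around its initial vertex, following the orientation, and `rev`
reverses each arc. These generate a transitive group on the arcs (the map is connected). -/
structure OrientedMap where
  Arc : Type
  nonempty : Nonempty Arc
  rot : Equiv.Perm Arc
  rev : Equiv.Perm Arc
  rev_sq : rev ^ 2 = 1
  connected : MulAction.IsPretransitive (Subgroup.closure {rot, rev}) Arc

namespace OrientedMap

/-- The rotation of arcs around faces: reverse the arc, then rotate backwards at its new initial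
vertex. Performing `rot`, then `rev`, then `face` gives the identity (the relation `xyz = 1` for
permutations that are composed from left to right). -/
def face (M : OrientedMap) : Equiv.Perm M.Arc := M.rot⁻¹ * M.rev

theorem face_mul_rev_mul_rot (M : OrientedMap) : M.face * M.rev * M.rot = 1 := by
  rw [face, mul_assoc M.rot⁻¹, ← sq, M.rev_sq]; simp

/-- Orientation-preserving isomorphism of maps: a bijection between the arcs that commutes with the
monodromy permutations. -/
def Isomorphic (M N : OrientedMap) : Prop :=
  ∃ e : M.Arc ≃ N.Arc, (∀ a, e (M.rot a) = N.rot (e a)) ∧ ∀ a, e (M.rev a) = N.rev (e a)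

/-- The orientation-preserving automorphism group of a map: the permutations of the arcs that
commute with `rot` and with `rev`. -/
def autGroup (M : OrientedMap) : Subgroup (Equiv.Perm M.Arc) :=
  Subgroup.centralizer {M.rot, M.rev}

/-- A map is orientably regular if its orientation-preserving automorphism group is transitive on
the arcs. -/
def OrientablyRegular (M : OrientedMap) : Prop := MulAction.IsPretransitive M.autGroup M.Arc

/-- The order of the vertex rotation; in an orientably regular map this is the valency of
each vertex. -/
noncomputable def valency (M : OrientedMap) : ℕ := orderOf M.rot

/-- The order of the face rotation; in an orientably regular map this is the number of sides of
each face. -/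
noncomputable def faceSize (M : OrientedMap) : ℕ := orderOf M.face

theorem pretransitive_of_le {X : Type} {H K : Subgroup (Equiv.Perm X)}
    (hHK : H ≤ K) (h : MulAction.IsPretransitive H X) : MulAction.IsPretransitive K X :=
  ⟨fun a b => by
    obtain ⟨g, hg⟩ := h.exists_smul_eq a b
    exact ⟨⟨g.1, hHK g.2⟩, hg⟩⟩

theorem centralizer_eq_of_closure_eq {G : Type} [Group G] {s t : Set G}
    (h : Subgroup.closure s = Subgroup.closure t) :
    Subgroup.centralizer s = Subgroup.centralizer t := by
  rw [← Subgroup.centralizer_closure s, h, Subgroup.centralizer_closure]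

theorem closure_face_rev (M : OrientedMap) :
    Subgroup.closure {M.face, M.rev} = Subgroup.closure {M.rot, M.rev} := by
  apply le_antisymm
  · rw [Subgroup.closure_le]
    rintro g (rfl | rfl)
    · exact mul_mem (inv_mem (Subgroup.subset_closure (by simp)))
        (Subgroup.subset_closure (by simp))
    · exact Subgroup.subset_closure (by simp)
  · rw [Subgroup.closure_le]
    rintro g (rfl | rfl)
    · have h : M.rot = M.rev * M.face⁻¹ := by simp [face]
      rw [h]
      exact mul_mem (Subgroup.subset_closure (by simp))
        (inv_mem (Subgroup.subset_closure (by simp)))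
    · exact Subgroup.subset_closure (by simp)

theorem closure_zpow_rev (M : OrientedMap) (j : ℤ) (hj : IsCoprime j (M.valency : ℤ)) :
    Subgroup.closure {M.rot ^ j, M.rev} = Subgroup.closure {M.rot, M.rev} := by
  apply le_antisymm
  · rw [Subgroup.closure_le]
    rintro g (rfl | rfl)
    · exact zpow_mem (Subgroup.subset_closure (by simp)) _
    · exact Subgroup.subset_closure (by simp)
  · rw [Subgroup.closure_le]
    rintro g (rfl | rfl)
    · obtain ⟨u, v, h⟩ := hj
      have h1 : M.rot = (M.rot ^ j) ^ u := by
        rw [← zpow_mul]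
        have h2 : M.rot ^ (u * j + v * (M.valency : ℤ)) = M.rot := by rw [h, zpow_one]
        rw [zpow_add, mul_comm v, zpow_mul M.rot (M.valency : ℤ), zpow_natCast, valency,
          pow_orderOf_eq_one, one_zpow, mul_one, mul_comm] at h2
        exact h2.symm
      have h3 : M.rot ^ j ∈ Subgroup.closure {M.rot ^ j, M.rev} :=
        Subgroup.subset_closure (Set.mem_insert _ _)
      have h4 := zpow_mem h3 u
      rwa [← h1] at h4
    · exact Subgroup.subset_closure (by simp)

/-- Duality `D`, transposing vertices and faces: the vertex rotation becomes the face rotation. -/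
def dual (M : OrientedMap) : OrientedMap where
  Arc := M.Arc
  nonempty := M.nonempty
  rot := M.face
  rev := M.rev
  rev_sq := M.rev_sq
  connected := pretransitive_of_le M.closure_face_rev.ge M.connected

/-- The hole operation `H_j`, for `j` coprime to the valency: the vertex rotation is replaced with
its `j`-th power. -/
def hole (M : OrientedMap) (j : ℤ) (hj : IsCoprime j (M.valency : ℤ)) : OrientedMap where
  Arc := M.Arc
  nonempty := M.nonempty
  rot := M.rot ^ j
  rev := M.rev
  rev_sq := M.rev_sq
  connected := pretransitive_of_le (M.closure_zpow_rev j hj).ge M.connected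

theorem autGroup_dual (M : OrientedMap) : M.dual.autGroup = M.autGroup :=
  centralizer_eq_of_closure_eq M.closure_face_rev

theorem autGroup_hole (M : OrientedMap) (j : ℤ) (hj : IsCoprime j (M.valency : ℤ)) :
    (M.hole j hj).autGroup = M.autGroup :=
  centralizer_eq_of_closure_eq (M.closure_zpow_rev j hj)

/-- A map and its dual have the same orientation-preserving automorphisms. -/
def autEquivDual (M : OrientedMap) : M.dual.autGroup ≃* M.autGroup where
  toFun g := ⟨g.1, M.autGroup_dual.le g.2⟩
  invFun g := ⟨g.1, M.autGroup_dual.ge g.2⟩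
  left_inv _ := rfl
  right_inv _ := rfl
  map_mul' _ _ := rfl

/-- The maps `M` and `H_j(M)` have the same orientation-preserving automorphisms. -/
def autEquivHole (M : OrientedMap) (j : ℤ) (hj : IsCoprime j (M.valency : ℤ)) :
    (M.hole j hj).autGroup ≃* M.autGroup where
  toFun g := ⟨g.1, (M.autGroup_hole j hj).le g.2⟩
  invFun g := ⟨g.1, (M.autGroup_hole j hj).ge g.2⟩
  left_inv _ := rfl
  right_inv _ := rfl
  map_mul' _ _ := rfl

end OrientedMap

/-- An orientably regular map with orientation-preserving automorphism group isomorphic to `G`. -/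
structure RegMap (G : Type) [Group G] where
  map : OrientedMap
  regular : map.OrientablyRegular
  aut : Nonempty (map.autGroup ≃* G)

namespace RegMap

variable {G : Type} [Group G]

/-- The dual map `D(M)`; it has the same orientation-preserving automorphism group as `M`. -/
def dual (M : RegMap G) : RegMap G where
  map := M.map.dual
  regular := OrientedMap.pretransitive_of_le M.map.autGroup_dual.ge M.regular
  aut := M.aut.map M.map.autEquivDual.trans

/-- The map `H_j(M)`; it has the same orientation-preserving automorphism group as `M`. -/
def hole (M : RegMap G) (j : ℤ) (hj : IsCoprime j (M.map.valency : ℤ)) : RegMap G where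
  map := M.map.hole j hj
  regular := OrientedMap.pretransitive_of_le (M.map.autGroup_hole j hj).ge M.regular
  aut := M.aut.map (M.map.autEquivHole j hj).trans

/-- A Hurwitz map: an orientably regular map of type `{3, 7}`, that is, with triangular faces and
vertices of valency `7` (used for finite `G` only, where the surface is compact). -/
def IsHurwitz (M : RegMap G) : Prop := M.map.faceSize = 3 ∧ M.map.valency = 7

/-- Isomorphism of orientably regular maps, as an equivalence relation. -/
instance isoSetoid (G : Type) [Group G] : Setoid (RegMap G) where
  r M N := M.map.Isomorphic N.map
  iseqv :=
    { refl := fun _ => ⟨Equiv.refl _, fun _ => rfl, fun _ => rfl⟩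
      symm := by
        rintro M N ⟨e, h1, h2⟩
        refine ⟨e.symm, fun a => ?_, fun a => ?_⟩
        · rw [Equiv.symm_apply_eq, h1, Equiv.apply_symm_apply]
        · rw [Equiv.symm_apply_eq, h2, Equiv.apply_symm_apply]
      trans := by
        rintro M N P ⟨e, h1, h2⟩ ⟨f, k1, k2⟩
        exact ⟨e.trans f, fun a => by simp [h1, k1], fun a => by simp [h2, k2]⟩ }

end RegMap

/-- The set `𝒪(G)` of isomorphism classes of orientably regular maps with orientation-preserving
automorphism group isomorphic to `G`. -/
def MapClass (G : Type) [Group G] : Type 1 := Quotient (RegMap.isoSetoid G)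

/-- The isomorphism class of an orientably regular map. -/
def RegMap.toClass {G : Type} [Group G] (M : RegMap G) : MapClass G :=
  Quotient.mk (RegMap.isoSetoid G) M

/-- `MapStep a b` if `b` is obtained from `a` by duality or by a hole operation. -/
inductive MapStep {G : Type} [Group G] : MapClass G → MapClass G → Prop
  | dual (M : RegMap G) : MapStep M.toClass M.dual.toClass
  | hole (M : RegMap G) (j : ℤ) (hj : IsCoprime j (M.map.valency : ℤ)) :
      MapStep M.toClass (M.hole j hj).toClass

/-- The graph `𝒪(G)`: its vertices are the isomorphism classes of orientably regular maps with
orientation-preserving automorphism group isomorphic to `G`, and its edges show the action of the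
operations `D` and `H_j` (all `j` coprime to the valency). Loops are omitted; directions do not
affect the connected components. -/
def mapGraph (G : Type) [Group G] : SimpleGraph (MapClass G) := SimpleGraph.fromRel MapStep

/-! The operations `D` and `H_j` keep the reversal `rev` and the group generated by `rot` and `rev`.
Hence the number of monodromy permutations commuting with `rev` is constant on the connected
components of `𝒪(G)`. For the map that a generating pair `(x, y)` defines on the group `G` itself,
this number is the order of the centralizer of `y`. It is therefore enough to find, in `A_n` for
large `n`, `m` Hurwitz pairs whose involutions have centralizers of different orders.

Such pairs come from permutation representations of the triangle group of type (2,3,7), drawn as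
diagrams: `i` copies of a diagram on 63 points and `j` copies of one on 64 points are joined in a
chain. The degree is `63 * i + 64 * j`, and the involution fixes `3 * i + 4` points (`card_point`,
`card_rev_fixed`). The orbits needed to verify the relations stay within three consecutive blocks,
so checking finitely many triples settles chains of every length (`iterate_eq_of_closes`).

A power of the commutator of the two generators is a double transposition supported in the first
block. With one of its conjugates it yields a three-cycle; the group is primitive, so by Jordan's
theorem it contains the alternating group (`alternatingGroup_le_closure_pair`). The generators are
even, since one has order 3 and their product has order 7, so the group is exactly alternating.

Exchanging 64 small blocks for 63 large ones preserves the degree and removes 192 fixed points. When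
there are enough small blocks, this strictly decreases the order of the centralizer
(`card_centralizer_lt`), even after the possible loss of a factor 2 in passing from the symmetric to
the alternating group. -/

namespace OrientedMap

/-! ### An invariant of the components of the graph of maps. -/

/-- The monodromy permutations that commute with the arc reversal. -/
def revCentralizer (M : OrientedMap) : Set (Equiv.Perm M.Arc) :=
  {g | g ∈ Subgroup.closure {M.rot, M.rev} ∧ Commute g M.rev}

theorem revCentralizer_dual (M : OrientedMap) : M.dual.revCentralizer = M.revCentralizer := by
  ext g
  change g ∈ Subgroup.closure {M.face, M.rev} ∧ _ ↔ _
  rw [M.closure_face_rev]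
  rfl

theorem revCentralizer_hole (M : OrientedMap) (j : ℤ) (hj : IsCoprime j (M.valency : ℤ)) :
    (M.hole j hj).revCentralizer = M.revCentralizer := by
  ext g
  change g ∈ Subgroup.closure {M.rot ^ j, M.rev} ∧ _ ↔ _
  rw [M.closure_zpow_rev j hj]
  rfl

/-- Conjugation by the bijection of arcs carries one monodromy group to the other and one reversal
to the other. -/
theorem Isomorphic.encard_revCentralizer {M N : OrientedMap} (h : M.Isomorphic N) :
    M.revCentralizer.encard = N.revCentralizer.encard := by
  obtain ⟨e, h1, h2⟩ := h
  let E : Equiv.Perm M.Arc ≃* Equiv.Perm N.Arc := e.permCongrHom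
  have hE : ∀ g : Equiv.Perm M.Arc, ∀ a, E g a = e (g (e.symm a)) := fun _ _ => rfl
  have hrot : E M.rot = N.rot := by ext a; rw [hE, h1, e.apply_symm_apply]
  have hrev : E M.rev = N.rev := by ext a; rw [hE, h2, e.apply_symm_apply]
  have hcl : (Subgroup.closure {M.rot, M.rev}).map E.toMonoidHom =
      Subgroup.closure {N.rot, N.rev} := by
    rw [MonoidHom.map_closure, Set.image_pair]
    simp [hrot, hrev]
  have himg : N.revCentralizer = E '' M.revCentralizer := by
    ext g
    constructor
    · rintro ⟨hg, hc⟩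
      rw [← hcl] at hg
      obtain ⟨k, hk, rfl⟩ := hg
      refine ⟨k, ⟨hk, ?_⟩, rfl⟩
      rw [← hrev] at hc
      exact (commute_map_iff E.injective).1 hc
    · rintro ⟨k, ⟨hk, hc⟩, rfl⟩
      refine ⟨?_, ?_⟩
      · rw [← hcl]; exact ⟨k, hk, rfl⟩
      · rw [← hrev]; exact hc.map E
  rw [himg, E.injective.encard_image]

end OrientedMap

/-- The number of monodromy permutations commuting with the arc reversal, on isomorphism classes. -/
noncomputable def MapClass.revCentralizerCard {G : Type} [Group G] (c : MapClass G) : ℕ∞ :=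
  Quotient.lift (fun M : RegMap G => M.map.revCentralizer.encard)
    (fun _ _ h => OrientedMap.Isomorphic.encard_revCentralizer h) c

theorem MapStep.revCentralizerCard_eq {G : Type} [Group G] {a b : MapClass G} (h : MapStep a b) :
    a.revCentralizerCard = b.revCentralizerCard := by
  cases h with
  | dual M => exact congrArg Set.encard M.map.revCentralizer_dual.symm
  | hole M j hj => exact congrArg Set.encard (M.map.revCentralizer_hole j hj).symm

theorem MapClass.revCentralizerCard_eq_of_reachable {G : Type} [Group G] {a b : MapClass G}
    (h : (mapGraph G).Reachable a b) : a.revCentralizerCard = b.revCentralizerCard := by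
  obtain ⟨p⟩ := h
  induction p with
  | nil => rfl
  | cons hadj _ ih =>
    rw [← ih]
    rw [mapGraph, SimpleGraph.fromRel_adj] at hadj
    rcases hadj.2 with h | h
    · exact h.revCentralizerCard_eq
    · exact h.revCentralizerCard_eq.symm

/-! ### Orientably regular maps from generating pairs of a group. -/

section CayleyMap

variable {G : Type} [Group G]

/-- Left translations, as permutations of the group. -/
abbrev leftReg (G : Type) [Group G] : G →* Equiv.Perm G := MulAction.toPermHom G G

theorem leftReg_injective : Function.Injective (leftReg G) := MulAction.toPerm_injective

theorem closure_leftReg {x y : G} (hxy : Subgroup.closure {x, y} = ⊤) :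
    Subgroup.closure {leftReg G x, leftReg G y} = (leftReg G).range := by
  rw [← Set.image_pair, ← MonoidHom.map_closure, hxy, MonoidHom.range_eq_map]

/-- The map whose arcs are the elements of a group generated by `x` and an involution `y`, with
`x` and `y` acting by left translation. -/
def cayleyMap (x y : G) (hy : y ^ 2 = 1) (hxy : Subgroup.closure {x, y} = ⊤) : OrientedMap where
  Arc := G
  nonempty := ⟨1⟩
  rot := leftReg G x
  rev := leftReg G y
  rev_sq := by rw [← map_pow, hy, map_one]
  connected := ⟨fun a b => ⟨⟨leftReg G (b * a⁻¹), by
    rw [closure_leftReg hxy]; exact ⟨_, rfl⟩⟩, by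
      change (b * a⁻¹) • a = b
      simp⟩⟩

/-- Right translations, as permutations commuting with left translations. -/
def rightReg (x y : G) :
    G →* Subgroup.centralizer ({leftReg G x, leftReg G y} : Set (Equiv.Perm G)) where
  toFun g := ⟨Equiv.mulRight g⁻¹, by
    rw [Subgroup.mem_centralizer_iff]
    rintro _ (rfl | rfl)
    · ext a; exact (mul_assoc x a g⁻¹).symm
    · ext a; exact (mul_assoc y a g⁻¹).symm⟩
  map_one' := by apply Subtype.ext; ext a; change a * 1⁻¹ = a; simp
  map_mul' g h := by
    apply Subtype.ext
    ext a
    change a * (g * h)⁻¹ = a * h⁻¹ * g⁻¹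
    simp [mul_assoc]

/-- A permutation commuting with all left translations is determined by its value at `1`, and is
right multiplication by that value. -/
theorem rightReg_bijective {x y : G} (hxy : Subgroup.closure {x, y} = ⊤) :
    Function.Bijective (rightReg x y) := by
  constructor
  · intro g h hgh
    have h1 : (1 : G) * g⁻¹ = 1 * h⁻¹ :=
      congrArg (fun f : Subgroup.centralizer _ => (f : Equiv.Perm G) 1) hgh
    simpa using h1
  · rintro ⟨f, hf⟩
    have hf' : f ∈ Subgroup.centralizer ((leftReg G).range : Set (Equiv.Perm G)) := by
      rw [← closure_leftReg hxy, Subgroup.centralizer_closure]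
      exact hf
    refine ⟨(f 1)⁻¹, Subtype.ext ?_⟩
    ext a
    change a * (f 1)⁻¹⁻¹ = f a
    have h1 := Subgroup.mem_centralizer_iff.1 hf' (leftReg G a) ⟨a, rfl⟩
    have h2 := congrArg (fun k : Equiv.Perm G => k 1) h1
    change a * f 1 = f (a * 1) at h2
    rw [inv_inv, h2, mul_one]

/-- The Cayley map of a generating pair is orientably regular with automorphism group `G`. -/
noncomputable def cayleyRegMap (x y : G) (hy : y ^ 2 = 1) (hxy : Subgroup.closure {x, y} = ⊤) :
    RegMap G where
  map := cayleyMap x y hy hxy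
  regular := ⟨fun (a b : G) => ⟨rightReg x y (b⁻¹ * a), by
    change a * (b⁻¹ * a)⁻¹ = b
    simp⟩⟩
  aut := ⟨(MulEquiv.ofBijective _ (rightReg_bijective hxy)).symm⟩

theorem cayleyRegMap_isHurwitz {x y : G} (hy : y ^ 2 = 1) (hxy : Subgroup.closure {x, y} = ⊤)
    (hx : orderOf x = 7) (hz : orderOf (x⁻¹ * y) = 3) : (cayleyRegMap x y hy hxy).IsHurwitz := by
  constructor
  · change orderOf ((leftReg G x)⁻¹ * leftReg G y) = 3
    rw [← map_inv, ← map_mul, orderOf_injective _ leftReg_injective, hz]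
  · change orderOf (leftReg G x) = 7
    rw [orderOf_injective _ leftReg_injective, hx]

/-- The monodromy group is the left regular image of `G`, in which commuting with `rev` amounts to
commuting with `y`. -/
theorem revCentralizerCard_cayleyRegMap {x y : G} (hy : y ^ 2 = 1)
    (hxy : Subgroup.closure {x, y} = ⊤) :
    (cayleyRegMap x y hy hxy).toClass.revCentralizerCard =
      ((Subgroup.centralizer {y} : Subgroup G) : Set G).encard := by
  change {g : Equiv.Perm G | g ∈ Subgroup.closure {leftReg G x, leftReg G y} ∧
    Commute g (leftReg G y)}.encard = _
  rw [closure_leftReg hxy, ← (leftReg_injective (G := G)).encard_image]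
  refine congrArg Set.encard (Set.ext fun g => ?_)
  constructor
  · rintro ⟨⟨k, rfl⟩, hc⟩
    refine ⟨k, ?_, rfl⟩
    rw [SetLike.mem_coe, Subgroup.mem_centralizer_singleton_iff]
    apply leftReg_injective
    simpa only [map_mul] using hc.eq
  · rintro ⟨k, hk, rfl⟩
    refine ⟨⟨k, rfl⟩, ?_⟩
    rw [SetLike.mem_coe, Subgroup.mem_centralizer_singleton_iff] at hk
    have := congrArg (leftReg G) hk
    rw [map_mul, map_mul] at this
    exact this

end CayleyMap

/-! ### Chains of diagrams, and local verification in windows of three blocks. -/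

/-- The building blocks of a chain: two diagrams with `63` and `64` points. The value `void` marks
the absence of a block, and `unknown` a block that is not specified. -/
inductive Block
  | void | small | large | unknown
  deriving DecidableEq

namespace Block

/-- The number of points of a block. -/
def size : Block → ℕ
  | small => 63
  | large => 64
  | _ => 0

/-- The involution of a block, coded by the number whose digits to base `64` are its values. -/
def revCode : Block → ℕ
  | small =>
      0x3ef7bf38dbad39c77c32d73ae9a2cbe5bad8e2aa09e67a47617d961671b51a4974153d344e2ca34c1c6248105083040
  | large =>
      0xfbfefaf7ce39d74df6c70cf2bafb2daab9e8a668e296479c6a166059f7544db4585cf54e4902ca34c1c6248105083040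
  | _ => 0

/-- The permutation of order three of a block, coded in the same way. -/
def turnCode : Block → ℕ
  | small =>
      0x3cfbdd77ebbe6ee2dbf3db4cb1c27864a9f9acae9a1c95b8e281e7556914d765858d50c4903ce24520b2831c6100081
  | large =>
      0xf7ffbcdf6efae78cefcb5d2dc70ba9b25ae4aa89e67d85e382285255b41e75c6993563144d13ce24520b2831c6100081
  | _ => 0

/-- The inverse of the permutation of order three of a block, coded in the same way. -/
def turnInvCode : Block → ℕ
  | small =>
      0x3df3ee39df5eb1ef0cafbadcf6d26969923b2786a7deadda1c6e28195545936915cf60e34c4902072c9144283181002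
  | large =>
      0xfbdffce78df6efacb1d73beed2dc2ba67b26964aa881e75f8d85d66955228526d03dc39934c4d12072c9144283181002
  | _ => 0

/-- The two points by which a block is joined to the next one; the points `0` and `1` join it to the
preceding one. -/
def port : Block → ℕ → ℕ
  | small, p => 61 + p
  | large, p => 38 + 2 * p
  | _, p => p

end Block

/-- The digit of `c` to base `64` at the position `p`. -/
def digit (c p : ℕ) : ℕ := c / 64 ^ p % 64

/-- A letter of a word in the involution and the permutation of order three. -/
inductive Letter
  | rev | turn | turnInv

namespace Chain

open Block Letter

/-- The action of a letter on the points `(k, p)`, the point `p` of the block `T k`. The involution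
exchanges the ports of a block with the points `0` and `1` of the next one. -/
def act (T : ℕ → Block) (l : Letter) (q : ℕ × ℕ) : ℕ × ℕ :=
  if T q.1 = unknown then q else
  match l with
  | turn => (q.1, digit (T q.1).turnCode q.2)
  | turnInv => (q.1, digit (T q.1).turnInvCode q.2)
  | rev =>
    if q.2 < 2 then
      if T (q.1 - 1) = void then q else (q.1 - 1, (T (q.1 - 1)).port q.2)
    else if q.2 = (T q.1).port 0 then
      if T (q.1 + 1) = void then q else (q.1 + 1, 0)
    else if q.2 = (T q.1).port 1 then
      if T (q.1 + 1) = void then q else (q.1 + 1, 1)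
    else (q.1, digit (T q.1).revCode q.2)

/-- The action of a word, read from left to right. -/
def run (T : ℕ → Block) (w : List Letter) (q : ℕ × ℕ) : ℕ × ℕ :=
  w.foldl (fun q l => act T l q) q

/-- Three consecutive blocks, the rest being unknown. -/
def window (a b c : Block) : ℕ → Block
  | 1 => a
  | 2 => b
  | 3 => c
  | _ => unknown

theorem act_of_unknown {T : ℕ → Block} {l : Letter} {q : ℕ × ℕ} (h : T q.1 = unknown) :
    act T l q = q := by
  simp [act, h]

theorem run_of_unknown {T : ℕ → Block} (w : List Letter) {q : ℕ × ℕ} (h : T q.1 = unknown) :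
    run T w q = q := by
  induction w with
  | nil => rfl
  | cons l w ih => rw [run, List.foldl_cons, act_of_unknown h]; exact ih

/-- The triples of blocks around position `m` in `T` agree with the window. -/
structure Sees (T : ℕ → Block) (m : ℕ) (a b c : Block) : Prop where
  pos : 1 ≤ m
  left : T (m - 1) = a
  mid : T m = b
  right : T (m + 1) = c
  known : ∀ k, T k ≠ unknown

/-- The embedding of a window centred at position `m` in a chain. -/
def shift (m : ℕ) (q : ℕ × ℕ) : ℕ × ℕ := (q.1 + m - 2, q.2)

/-- A letter consults only the block of a point and its two neighbours. The window lacks information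
only when the image falls into an `unknown` block. -/
theorem act_shift {T : ℕ → Block} {m : ℕ} {a b c : Block} (hT : Sees T m a b c) (l : Letter)
    (q : ℕ × ℕ) (hq : window a b c (act (window a b c) l q).1 ≠ unknown) :
    act T l (shift m q) = shift m (act (window a b c) l q) := by
  obtain ⟨hm, rfl, rfl, rfl, hk⟩ := hT
  obtain ⟨k, p⟩ := q
  obtain ⟨m, rfl⟩ : ∃ m', m = m' + 1 := ⟨m - 1, by omega⟩
  have hm1 := hk m
  have hm2 := hk (m + 1)
  have hm3 := hk (m + 2)
  match k with
  | 0 => simp [act_of_unknown, window] at hq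
  | 1 =>
    have e : 1 + (m + 1) - 2 = m := by omega
    cases l
    · simp only [act, shift, window, e, hm1, if_false, Nat.add_sub_cancel] at hq ⊢
      split_ifs at hq ⊢ <;> simp_all
    · simp [act, shift, window, e, hm1]
    · simp [act, shift, window, e, hm1]
  | 2 =>
    have e : 2 + (m + 1) - 2 = m + 1 := by omega
    cases l
    · simp only [act, shift, window, e, hm2, if_false, Nat.add_sub_cancel] at hq ⊢
      split_ifs at hq ⊢ <;> simp_all <;> omega
    · simp [act, shift, window, e, hm2]
    · simp [act, shift, window, e, hm2]
  | 3 =>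
    have e : 3 + (m + 1) - 2 = m + 2 := by omega
    cases l
    · simp only [act, shift, window, e, hm3, if_false, Nat.add_sub_cancel] at hq ⊢
      split_ifs at hq ⊢ <;> simp_all
    · simp [act, shift, window, e, hm3]
    · simp [act, shift, window, e, hm3]
  | k + 4 => simp [act_of_unknown, window] at hq

/-- Only the end of the path has to be tested: points of `unknown` blocks are frozen, so a path that
has left the window cannot come back. -/
theorem run_shift {T : ℕ → Block} {m : ℕ} {a b c : Block} (hT : Sees T m a b c)
    (w : List Letter) (q : ℕ × ℕ) (hq : window a b c (run (window a b c) w q).1 ≠ unknown) :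
    run T w (shift m q) = shift m (run (window a b c) w q) := by
  induction w generalizing q with
  | nil => rfl
  | cons l w ih =>
    change run T w (act T l (shift m q)) = shift m (run _ w (act _ l q))
    rw [act_shift hT l q, ih]
    · exact hq
    · intro h
      exact hq (by change window a b c (run _ w (act _ l q)).1 = _; rw [run_of_unknown w h, h])

theorem iterate_run_shift {T : ℕ → Block} {m : ℕ} {a b c : Block} (hT : Sees T m a b c)
    (w : List Letter) (n : ℕ) (q : ℕ × ℕ)
    (hq : window a b c ((run (window a b c) w)^[n] q).1 ≠ unknown) :
    (run T w)^[n] (shift m q) = shift m ((run (window a b c) w)^[n] q) := by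
  induction n generalizing q with
  | zero => rfl
  | succ n ih =>
    rw [Function.iterate_succ_apply] at hq
    rw [Function.iterate_succ_apply, Function.iterate_succ_apply, run_shift hT w q, ih _ hq]
    intro h
    refine hq ?_
    have hfix : Function.IsFixedPt (run (window a b c) w) (run (window a b c) w q) :=
      run_of_unknown w h
    rw [hfix.iterate n, h]

theorem shift_two (m p : ℕ) : shift m (2, p) = (m, p) := by simp [shift]

/-- Whether the orbit of `q` under `f`, currently at the iterate `x` of order `c`, returns to `q`
within the given number of steps, after a number of steps that divides `K`. -/
def returns (f : ℕ × ℕ → ℕ × ℕ) (K : ℕ) (q : ℕ × ℕ) : ℕ → ℕ → ℕ × ℕ → Bool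
  | 0, _, _ => false
  | n + 1, c, x => if f x = q then K % (c + 1) = 0 else returns f K q n (c + 1) (f x)

theorem exists_iterate_of_returns {f : ℕ × ℕ → ℕ × ℕ} {K : ℕ} {q : ℕ × ℕ} (n c : ℕ) {x : ℕ × ℕ}
    (h : returns f K q n c x = true) (hx : f^[c] q = x) : ∃ d, d ∣ K ∧ f^[d] q = q := by
  induction n generalizing c x with
  | zero => simp [returns] at h
  | succ n ih =>
    have hx' : f^[c + 1] q = f x := by rw [Function.iterate_succ_apply', hx]
    rw [returns] at h
    split_ifs at h with h1
    · exact ⟨c + 1, Nat.dvd_of_mod_eq_zero (by simpa using h), hx'.trans h1⟩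
    · exact ih (c + 1) h hx'

/-- Whether the orbit of a point of the middle block of a window under a word stays in the window
and has a length dividing `K`. -/
def closes (w : List Letter) (K : ℕ) (a b c : Block) (p : ℕ) : Bool :=
  -- The bound `50` is only fuel: an orbit that needs more steps makes the test fail.
  decide (b ≠ unknown) && returns (run (window a b c) w) K (2, p) 50 0 (2, p)

theorem iterate_eq_of_closes {T : ℕ → Block} {m : ℕ} {a b c : Block} (hT : Sees T m a b c)
    {w : List Letter} {K p : ℕ} (h : closes w K a b c p = true) :
    (run T w)^[K] (m, p) = (m, p) := by
  simp only [closes, Bool.and_eq_true, decide_eq_true_eq] at h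
  obtain ⟨d, ⟨e, rfl⟩, hd⟩ := exists_iterate_of_returns 50 0 h.2 rfl
  have hT' := iterate_run_shift hT w d (2, p) (by rw [hd]; exact h.1)
  rw [hd, shift_two] at hT'
  rw [Function.iterate_mul]
  exact Function.IsFixedPt.iterate hT' e

/-- A chain of `i` small blocks followed by `j` large ones. -/
def pattern (i j k : ℕ) : Block :=
  if k = 0 then void else if k ≤ i then small else if k ≤ i + j then large else void

/-- The triples of consecutive blocks in a chain. -/
def triples : List (Block × Block × Block) :=
  [(void, small, small), (small, small, small), (small, small, large), (small, large, large),
    (large, large, large), (large, large, void)]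

/-- Whether a property holds at all points of the middle blocks of the triples in a chain. -/
def everywhere (P : Block → Block → Block → ℕ → Bool) : Bool :=
  triples.all fun t => (List.range t.2.1.size).all (P t.1 t.2.1 t.2.2)

theorem pattern_small {i j k : ℕ} (h : 1 ≤ k) (h' : k ≤ i) : pattern i j k = small := by
  rw [pattern, if_neg (by omega), if_pos h']

theorem pattern_large {i j k : ℕ} (h : i < k) (h' : k ≤ i + j) : pattern i j k = large := by
  rw [pattern, if_neg (by omega), if_neg (by omega), if_pos h']

theorem pattern_of_lt {i j k : ℕ} (h : i + j < k) : pattern i j k = void := by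
  rw [pattern, if_neg (by omega), if_neg (by omega), if_neg (by omega)]

theorem pattern_ne_unknown (i j k : ℕ) : pattern i j k ≠ unknown := by
  unfold pattern
  split_ifs <;> simp

/-- With at least two blocks of each kind, no block has an end of the chain on one side and the
other kind on the other side, so six triples suffice. -/
theorem exists_sees {i j : ℕ} (hi : 2 ≤ i) (hj : 2 ≤ j) {m : ℕ} (hm : 1 ≤ m) (hm' : m ≤ i + j) :
    ∃ t ∈ triples, Sees (pattern i j) m t.1 t.2.1 t.2.2 := by
  have hk := pattern_ne_unknown i j
  rcases Nat.lt_trichotomy m i with h | h | h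
  · rcases Nat.eq_or_lt_of_le hm with h1 | h1
    · exact ⟨(void, small, small), by simp [triples], hm, by rw [← h1]; rfl,
        pattern_small hm (by omega), pattern_small (by omega) (by omega), hk⟩
    · exact ⟨(small, small, small), by simp [triples], hm, pattern_small (by omega) (by omega),
        pattern_small hm (by omega), pattern_small (by omega) (by omega), hk⟩
  · exact ⟨(small, small, large), by simp [triples], hm, pattern_small (by omega) (by omega),
      pattern_small hm (by omega), pattern_large (by omega) (by omega), hk⟩
  · rcases Nat.eq_or_lt_of_le (show i + 1 ≤ m from h) with h1 | h1
    · exact ⟨(small, large, large), by simp [triples], hm, pattern_small (by omega) (by omega),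
        pattern_large h hm', pattern_large (by omega) (by omega), hk⟩
    · rcases Nat.eq_or_lt_of_le hm' with h2 | h2
      · exact ⟨(large, large, void), by simp [triples], hm, pattern_large (by omega) (by omega),
          pattern_large h hm', pattern_of_lt (by omega), hk⟩
      · exact ⟨(large, large, large), by simp [triples], hm, pattern_large (by omega) (by omega),
          pattern_large h hm', pattern_large (by omega) (by omega), hk⟩

theorem exists_sees_of_everywhere {P : Block → Block → Block → ℕ → Bool}
    (hP : everywhere P = true) {i j : ℕ} (hi : 2 ≤ i) (hj : 2 ≤ j) {m p : ℕ}
    (hp : p < (pattern i j m).size) :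
    ∃ a b c, Sees (pattern i j) m a b c ∧ P a b c p = true := by
  have hm : 1 ≤ m ∧ m ≤ i + j := by
    by_contra hcon
    have : pattern i j m = void := by unfold pattern; split_ifs <;> first | rfl | omega
    rw [this] at hp
    exact absurd hp (Nat.not_lt_zero p)
  obtain ⟨t, ht, hs⟩ := exists_sees hi hj hm.1 hm.2
  refine ⟨_, _, _, hs, ?_⟩
  rw [everywhere, List.all_eq_true] at hP
  have h1 := hP t ht
  rw [List.all_eq_true] at h1
  exact h1 p (List.mem_range.2 (hs.mid ▸ hp))

end Chain

/-! ### A criterion for containing the alternating group. -/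

section Generation

open Equiv Equiv.Perm MulAction
open scoped Pointwise

variable {α : Type*} [DecidableEq α]

/-- Two double transpositions moving exactly one common point give a three-cycle. -/
theorem swap_mul_swap_mul_pow_four [Fintype α] {z a b x y x' y' : α}
    (h : [z, a, b, x, y, x', y'].Nodup) :
    (swap z a * swap x y * (swap z b * swap x' y')) ^ 4 = swap z a * swap z b := by
  simp only [List.nodup_cons, List.mem_cons, List.not_mem_nil, or_false, not_or,
    List.nodup_nil] at h
  obtain ⟨⟨hza, hzb, hzx, hzy, hzx', hzy'⟩, ⟨hab, hax, hay, hax', hay'⟩,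
    ⟨hbx, hby, hbx', hby'⟩, ⟨hxy, hxx', hxy'⟩, ⟨hyx', hyy'⟩, hx'y', -⟩ := h
  have hd : ∀ p q r t : α, p ≠ q → p ≠ r → p ≠ t → q ≠ r → q ≠ t → r ≠ t →
      Commute (swap p q) (swap r t) := fun p q r t h1 h2 h3 h4 h5 h6 =>
    (disjoint_swap_swap (by simp [*])).commute
  have c1 : Commute (swap z a) (swap x y) := hd _ _ _ _ hza hzx hzy hax hay hxy
  have c2 : Commute (swap z b) (swap x y) := hd _ _ _ _ hzb hzx hzy hbx hby hxy
  have c3 : Commute (swap z a) (swap x' y') := hd _ _ _ _ hza hzx' hzy' hax' hay' hx'y'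
  have c4 : Commute (swap z b) (swap x' y') := hd _ _ _ _ hzb hzx' hzy' hbx' hby' hx'y'
  have c5 : Commute (swap x y) (swap x' y') := hd _ _ _ _ hxy hxx' hxy' hyx' hyy' hx'y'
  have e1 : swap z a * swap x y * (swap z b * swap x' y') =
      swap z a * swap z b * (swap x y * swap x' y') := by
    rw [mul_assoc, ← mul_assoc (swap x y), ← c2.eq]; simp only [mul_assoc]
  have hcomm : Commute (swap z a * swap z b) (swap x y * swap x' y') :=
    (c1.mul_left c2).mul_right (c3.mul_left c4)
  -- The fourth power kills the disjoint transpositions and fixes the three-cycle, as 4 ≡ 1 modulo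
  -- 3.
  have e2 : (swap x y * swap x' y') ^ 4 = 1 := by
    rw [c5.mul_pow, show 4 = 2 * 2 from rfl, pow_mul, pow_mul, sq (swap x y), sq (swap x' y'),
      swap_mul_self, swap_mul_self, one_pow, one_mul]
  have e3 : (swap z a * swap z b) ^ 3 = 1 := by
    rw [← (isThreeCycle_swap_mul_swap_same hza hzb hab).orderOf, pow_orderOf_eq_one]
  rw [e1, hcomm.mul_pow, e2, mul_one, pow_succ, e3, one_mul]

/-- A transitive group generated by `s` and `u` contains the alternating group as soon as it
contains a suitable double transposition moving a fixed point of `s`. -/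
theorem alternatingGroup_le_closure_pair [Fintype α] {s u c g h : Perm α}
    (hT : IsPretransitive (Subgroup.closure {s, u}) α)
    (hc : c ∈ Subgroup.closure {s, u}) (hg : g ∈ Subgroup.closure {s, u})
    (hh : h ∈ Subgroup.closure {s, u}) {z a b x y x' y' : α}
    (hnd : [z, a, b, x, y, x', y'].Nodup) (hcz : c = swap z a * swap x y)
    (hgz : g z = z) (hga : g a = b) (hgx : g x = x') (hgy : g y = y')
    (hsz : s z = z) (hhz : h z = z) {k l : ℕ} (hu : u ((h ^ k) a) = (h ^ l) a) :
    alternatingGroup α ≤ Subgroup.closure {s, u} := by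
  set H := Subgroup.closure {s, u} with hH
  have hs : s ∈ H := Subgroup.subset_closure (by simp)
  have hu' : u ∈ H := Subgroup.subset_closure (by simp)
  have hc' : g * c * g⁻¹ = swap z b * swap x' y' := by
    have : g * (swap z a * swap x y) * g⁻¹ = (g * swap z a * g⁻¹) * (g * swap x y * g⁻¹) := by
      group
    rw [hcz, this, ← swap_apply_apply, ← swap_apply_apply, hgz, hga, hgx, hgy]
  have hσ : swap z a * swap z b ∈ H := by
    rw [← swap_mul_swap_mul_pow_four hnd, ← hcz, ← hc']
    exact pow_mem (mul_mem hc (mul_mem (mul_mem hg hc) (inv_mem hg))) 4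
  have hne := hnd
  simp only [List.nodup_cons, List.mem_cons, List.not_mem_nil, or_false, not_or,
    List.nodup_nil] at hne
  have hza : z ≠ a := hne.1.1
  have hzb : z ≠ b := hne.1.2.1
  have hab : a ≠ b := hne.2.1.1
  refine alternatingGroup_le_of_isPreprimitive_of_isThreeCycle_mem ?_
    (isThreeCycle_swap_mul_swap_same hza hzb hab) hσ
  set σ := swap z a * swap z b with hσdef
  have hσz : σ z = b := by
    rw [hσdef, Perm.mul_apply, swap_apply_left, swap_apply_of_ne_of_ne hzb.symm hab.symm]
  have hσb : σ b = a := by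
    rw [hσdef, Perm.mul_apply, swap_apply_right, swap_apply_left]
  have hσa : σ a = z := by
    rw [hσdef, Perm.mul_apply, swap_apply_of_ne_of_ne hza.symm hab, swap_apply_right]
  -- a block containing `z` and another point is everything
  have key : ∀ B : Set α, IsBlock H B → z ∈ B → (∃ p ∈ B, p ≠ z) → B = Set.univ := by
    rintro B hB hz ⟨p, hp, hpz⟩
    have hst : ∀ f : Perm α, ∀ hf : f ∈ H, ∀ q ∈ B, f q ∈ B → (⟨f, hf⟩ : H) • B = B :=
      fun f hf q hq hfq => hB.smul_eq_of_mem hq hfq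
    have happ : ∀ f : Perm α, ∀ hf : f ∈ H, (⟨f, hf⟩ : H) • B = B → ∀ q ∈ B, f q ∈ B := by
      intro f hf hfB q hq
      rw [← hfB]
      exact ⟨q, hq, rfl⟩
    -- The three-cycle sends some point of `B` into `B`: either `p` is one of `a`, `b`, and `z` is
    -- at hand, or `p` is fixed.
    have hσB : (⟨σ, hσ⟩ : H) • B = B := by
      by_cases hpa : p = a
      · exact hst σ hσ p hp (by rw [hpa, hσa]; exact hz)
      by_cases hpb : p = b
      · exact hst σ hσ z hz (by rw [hσz, ← hpb]; exact hp)
      · refine hst σ hσ p hp ?_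
        rw [hσdef, Perm.mul_apply, swap_apply_of_ne_of_ne hpz hpb,
          swap_apply_of_ne_of_ne hpz hpa]
        exact hp
    have hbB : b ∈ B := hσz ▸ happ σ hσ hσB z hz
    have haB : a ∈ B := hσb ▸ happ σ hσ hσB b hbB
    -- As `h` fixes `z`, it preserves `B`; so `B` contains the orbit of `a` under `h`, and `hu` then
    -- forces `u` to preserve `B` too.
    have hhB : ∀ n : ℕ, (h ^ n) a ∈ B := by
      intro n
      induction n with
      | zero => exact haB
      | succ n ih =>
        rw [pow_succ', Perm.mul_apply]
        exact happ h hh (hst h hh z hz (by rw [hhz]; exact hz)) _ ih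
    have hall : ∀ f : Perm α, ∀ hf : f ∈ H, (⟨f, hf⟩ : H) • B = B := by
      intro f hf
      induction hf using Subgroup.closure_induction with
      | mem f hf =>
        rcases hf with rfl | rfl
        · exact hst _ hs z hz (by rw [hsz]; exact hz)
        · exact hst _ hu' _ (hhB k) (by rw [hu]; exact hhB l)
      | one => exact one_smul _ B
      | mul f f' hf hf' h1 h2 =>
        change ((⟨f, hf⟩ : H) * ⟨f', hf'⟩) • B = B
        rw [mul_smul, h2, h1]
      | inv f hf h1 =>
        change (⟨f, hf⟩ : H)⁻¹ • B = B
        rw [inv_smul_eq_iff, h1]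
    refine Set.eq_univ_of_forall fun q => ?_
    obtain ⟨⟨f, hf⟩, rfl⟩ := hT.exists_smul_eq z q
    exact happ f hf (hall f hf) z hz
  -- By transitivity a block with two points can be translated to one that contains `z`.
  refine { hT with isTrivialBlock_of_isBlock := fun {B} hB => ?_ }
  by_cases hsub : B.Subsingleton
  · exact Or.inl hsub
  right
  obtain ⟨p, hp, q, hq, hpq⟩ := Set.not_subsingleton_iff.1 hsub
  obtain ⟨f, hf⟩ := hT.exists_smul_eq p z
  have := key (f • B) (hB.translate f) ⟨p, hp, hf⟩
    ⟨f • q, ⟨q, hq, rfl⟩, fun h => hpq (smul_left_cancel f (hf.trans h.symm))⟩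
  rw [← inv_smul_smul f B, this, Set.smul_set_univ]

end Generation

/-! ### The permutations defined by a chain, and the finite checks behind them. -/

namespace Chain

open Block Letter Equiv

theorem Sees.window_eq {T : ℕ → Block} {m : ℕ} {a b c : Block} (hT : Sees T m a b c) {k : ℕ}
    (hk : window a b c k ≠ unknown) : T (k + m - 2) = window a b c k := by
  obtain ⟨hm, rfl, rfl, rfl, -⟩ := hT
  match k with
  | 0 => exact absurd rfl hk
  | 1 => rw [show 1 + m - 2 = m - 1 by omega]; rfl
  | 2 => rw [show 2 + m - 2 = m by omega]; rfl
  | 3 => rw [show 3 + m - 2 = m + 1 by omega]; rfl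
  | k + 4 => exact absurd rfl hk

/-- The points of a chain. -/
abbrev Point (i j : ℕ) : Type := {q : ℕ × ℕ // q.2 < (pattern i j q.1).size}

/-- Since `unknown` has size `0`, this also shows that one letter never leads from the middle block
out of the window. -/
theorem everywhere_lt_size (l : Letter) : everywhere (fun a b c p =>
    decide ((act (window a b c) l (2, p)).2 <
      (window a b c (act (window a b c) l (2, p)).1).size)) = true := by
  cases l <;> decide +kernel

theorem everywhere_rev_sq : everywhere (closes [rev, rev] 1) = true := by decide +kernel

theorem everywhere_turn_turnInv : everywhere (closes [turn, turnInv] 1) = true := by decide +kernel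

theorem everywhere_turnInv_turn : everywhere (closes [turnInv, turn] 1) = true := by decide +kernel

theorem everywhere_turn_cube : everywhere (closes [turn] 3) = true := by decide +kernel

theorem everywhere_rot_pow : everywhere (closes [turnInv, rev] 7) = true := by decide +kernel

/-- The exponent is 2·3·7·13·17·23, a multiple of the lengths of all cycles of the commutator except
one 4-cycle, formed by the four exempted points of the first block. Being 2 modulo 4, it turns this
4-cycle into a double transposition. -/
theorem everywhere_commutator_pow : everywhere (fun a b c p =>
    (a = void && (p = 0 || p = 4 || p = 5 || p = 14)) ||
      closes [rev, turnInv, rev, turn] 213486 a b c p) = true := by decide +kernel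

/-- With points ordered by block and then by number, one of the two letters moves every point except
the very first to an earlier one. This is the induction step for transitivity. -/
theorem everywhere_descent : everywhere (fun a b c p =>
    (a = void && p = 0) || [rev, turnInv].any fun l =>
      (act (window a b c) l (2, p)).1 = 1 ||
        ((act (window a b c) l (2, p)).1 = 2 && (act (window a b c) l (2, p)).2 < p)) = true := by
  decide +kernel

theorem iterate_run_eq {i j : ℕ} (hi : 2 ≤ i) (hj : 2 ≤ j) {w : List Letter} {K : ℕ}
    (h : everywhere (closes w K) = true) (q : Point i j) :
    (run (pattern i j) w)^[K] q.1 = q.1 := by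
  obtain ⟨a, b, c, hs, hc⟩ := exists_sees_of_everywhere h hi hj q.2
  exact iterate_eq_of_closes hs hc

theorem act_lt_size {i j : ℕ} (hi : 2 ≤ i) (hj : 2 ≤ j) (l : Letter) (q : Point i j) :
    (act (pattern i j) l q.1).2 < (pattern i j (act (pattern i j) l q.1).1).size := by
  obtain ⟨⟨m, p⟩, hq⟩ := q
  obtain ⟨a, b, c, hs, hc⟩ := exists_sees_of_everywhere (everywhere_lt_size l) hi hj hq
  rw [decide_eq_true_eq] at hc
  have hu : window a b c (act (window a b c) l (2, p)).1 ≠ unknown := by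
    intro h
    rw [h] at hc
    exact absurd hc (Nat.not_lt_zero _)
  have := act_shift hs l (2, p) hu
  rw [shift_two] at this
  change (act (pattern i j) l (m, p)).2 < (pattern i j (act (pattern i j) l (m, p)).1).size
  rw [this]
  change _ < (pattern i j (_ + m - 2)).size
  rw [hs.window_eq hu]
  exact hc

/-- The action of a letter on the points of a chain. -/
def actPoint {i j : ℕ} (hi : 2 ≤ i) (hj : 2 ≤ j) (l : Letter) (q : Point i j) : Point i j :=
  ⟨act (pattern i j) l q.1, act_lt_size hi hj l q⟩

/-- The permutation of the points of a chain given by a letter. -/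
def letterPerm {i j : ℕ} (hi : 2 ≤ i) (hj : 2 ≤ j) : Letter → Perm (Point i j)
  | rev => ⟨actPoint hi hj rev, actPoint hi hj rev,
      fun q => Subtype.ext (iterate_run_eq hi hj everywhere_rev_sq q),
      fun q => Subtype.ext (iterate_run_eq hi hj everywhere_rev_sq q)⟩
  | turn => ⟨actPoint hi hj turn, actPoint hi hj turnInv,
      fun q => Subtype.ext (iterate_run_eq hi hj everywhere_turn_turnInv q),
      fun q => Subtype.ext (iterate_run_eq hi hj everywhere_turnInv_turn q)⟩
  | turnInv => ⟨actPoint hi hj turnInv, actPoint hi hj turn,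
      fun q => Subtype.ext (iterate_run_eq hi hj everywhere_turnInv_turn q),
      fun q => Subtype.ext (iterate_run_eq hi hj everywhere_turn_turnInv q)⟩

/-- The permutation of the points of a chain given by a word. -/
def wordPerm {i j : ℕ} (hi : 2 ≤ i) (hj : 2 ≤ j) : List Letter → Perm (Point i j)
  | [] => 1
  | l :: w => wordPerm hi hj w * letterPerm hi hj l

theorem wordPerm_apply {i j : ℕ} (hi : 2 ≤ i) (hj : 2 ≤ j) (w : List Letter) (q : Point i j) :
    (wordPerm hi hj w q).1 = run (pattern i j) w q.1 := by
  induction w generalizing q with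
  | nil => rfl
  | cons l w ih =>
    rw [wordPerm, Perm.mul_apply, ih]
    cases l <;> rfl

theorem wordPerm_pow_apply {i j : ℕ} (hi : 2 ≤ i) (hj : 2 ≤ j) (w : List Letter) (n : ℕ)
    (q : Point i j) : ((wordPerm hi hj w ^ n) q).1 = (run (pattern i j) w)^[n] q.1 := by
  induction n with
  | zero => rfl
  | succ n ih => rw [pow_succ', Perm.mul_apply, wordPerm_apply, ih, Function.iterate_succ_apply']

theorem wordPerm_pow_eq_one {i j : ℕ} (hi : 2 ≤ i) (hj : 2 ≤ j) {w : List Letter} {K : ℕ}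
    (h : everywhere (closes w K) = true) : wordPerm hi hj w ^ K = 1 :=
  Equiv.ext fun q => Subtype.ext (by
    rw [wordPerm_pow_apply, iterate_run_eq hi hj h]; rfl)

theorem letterPerm_mem {i j : ℕ} (hi : 2 ≤ i) (hj : 2 ≤ j) (l : Letter) :
    letterPerm hi hj l ∈ Subgroup.closure {letterPerm hi hj rev, letterPerm hi hj turn} := by
  cases l
  · exact Subgroup.subset_closure (by simp)
  · exact Subgroup.subset_closure (by simp)
  · exact inv_mem (Subgroup.subset_closure (by simp) :
      letterPerm hi hj turn ∈ Subgroup.closure {letterPerm hi hj rev, letterPerm hi hj turn})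

theorem wordPerm_mem {i j : ℕ} (hi : 2 ≤ i) (hj : 2 ≤ j) (w : List Letter) :
    wordPerm hi hj w ∈ Subgroup.closure {letterPerm hi hj rev, letterPerm hi hj turn} := by
  induction w with
  | nil => exact one_mem _
  | cons l w ih => exact mul_mem ih (letterPerm_mem hi hj l)

/-- The points of the first block. -/
def firstBlock {i j : ℕ} (hi : 2 ≤ i) (p : ℕ) (hp : p < 63) : Point i j :=
  ⟨(1, p), by rw [pattern_small le_rfl (by omega)]; exact hp⟩

theorem sees_one {i : ℕ} (j : ℕ) (hi : 2 ≤ i) : Sees (pattern i j) 1 void small small :=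
  ⟨le_rfl, rfl, pattern_small le_rfl (by omega), pattern_small (by omega) (by omega),
    pattern_ne_unknown i j⟩

theorem wordPerm_pow_firstBlock {i j : ℕ} (hi : 2 ≤ i) (hj : 2 ≤ j) {w : List Letter} {n p p' : ℕ}
    (hp : p < 63) (hp' : p' < 63)
    (h : (run (window void small small) w)^[n] (2, p) = (2, p')) :
    (wordPerm hi hj w ^ n) (firstBlock hi p hp) = firstBlock hi p' hp' := by
  apply Subtype.ext
  rw [wordPerm_pow_apply]
  have := iterate_run_shift (sees_one j hi) w n (2, p) (by rw [h]; simp [window])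
  rw [h, shift_two, shift_two] at this
  exact this

theorem wordPerm_firstBlock {i j : ℕ} (hi : 2 ≤ i) (hj : 2 ≤ j) {w : List Letter} {p p' : ℕ}
    (hp : p < 63) (hp' : p' < 63) (h : run (window void small small) w (2, p) = (2, p')) :
    wordPerm hi hj w (firstBlock hi p hp) = firstBlock hi p' hp' :=
  wordPerm_pow_firstBlock hi hj (n := 1) hp hp' h

theorem Sees.eq_one {i j m : ℕ} {b c : Block} (hs : Sees (pattern i j) m void b c)
    (hb : b ≠ void) : m = 1 := by
  have h1 := hs.left
  have h2 := hs.mid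
  have h3 := hs.pos
  have h4 : m ≤ i + j := by
    by_contra hcon
    exact hb (h2.symm.trans (pattern_of_lt (by omega)))
  by_contra hcon
  rcases le_or_gt (m - 1) i with h5 | h5
  · rw [pattern_small (by omega) h5] at h1; cases h1
  · rw [pattern_large h5 (by omega)] at h1; cases h1

/-- A power of the commutator is a double transposition. -/
theorem commutator_pow_eq {i j : ℕ} (hi : 2 ≤ i) (hj : 2 ≤ j) :
    wordPerm hi hj [rev, turnInv, rev, turn] ^ 213486 =
      swap (firstBlock hi 0 (by omega)) (firstBlock hi 14 (by omega)) *
        swap (firstBlock hi 4 (by omega)) (firstBlock hi 5 (by omega)) := by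
  have hne : ∀ p p' : ℕ, ∀ hp : p < 63, ∀ hp' : p' < 63, p ≠ p' →
      (firstBlock hi p hp : Point i j) ≠ firstBlock hi p' hp' :=
    fun p p' _ _ h h' => h (congrArg (fun q : Point i j => q.1.2) h')
  have hmove : ∀ p p' : ℕ, ∀ hp : p < 63, ∀ hp' : p' < 63,
      (run (window void small small) [rev, turnInv, rev, turn])^[4] (2, p) = (2, p) →
      (run (window void small small) [rev, turnInv, rev, turn])^[2] (2, p) = (2, p') →
      (wordPerm hi hj [rev, turnInv, rev, turn] ^ 213486) (firstBlock hi p hp) =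
        firstBlock hi p' hp' := by
    intro p p' hp hp' h4 h2
    -- On a 4-cycle only the exponent modulo 4 matters.
    rw [show 213486 = 2 + 4 * 53371 from rfl, pow_add, pow_mul, Perm.mul_apply,
      Perm.pow_apply_eq_self_of_apply_eq_self (wordPerm_pow_firstBlock hi hj hp hp h4),
      wordPerm_pow_firstBlock hi hj hp hp' h2]
  ext1 q
  by_cases h0 : q = firstBlock hi 0 (by omega)
  · rw [h0, hmove 0 14 (by omega) (by omega) (by decide +kernel) (by decide +kernel),
      Perm.mul_apply, swap_apply_of_ne_of_ne (hne _ _ _ _ (by omega)) (hne _ _ _ _ (by omega)),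
      swap_apply_left]
  by_cases h14 : q = firstBlock hi 14 (by omega)
  · rw [h14, hmove 14 0 (by omega) (by omega) (by decide +kernel) (by decide +kernel),
      Perm.mul_apply, swap_apply_of_ne_of_ne (hne _ _ _ _ (by omega)) (hne _ _ _ _ (by omega)),
      swap_apply_right]
  by_cases h4 : q = firstBlock hi 4 (by omega)
  · rw [h4, hmove 4 5 (by omega) (by omega) (by decide +kernel) (by decide +kernel),
      Perm.mul_apply, swap_apply_left,
      swap_apply_of_ne_of_ne (hne _ _ _ _ (by omega)) (hne _ _ _ _ (by omega))]
  by_cases h5 : q = firstBlock hi 5 (by omega)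
  · rw [h5, hmove 5 4 (by omega) (by omega) (by decide +kernel) (by decide +kernel),
      Perm.mul_apply, swap_apply_right,
      swap_apply_of_ne_of_ne (hne _ _ _ _ (by omega)) (hne _ _ _ _ (by omega))]
  rw [Perm.mul_apply, swap_apply_of_ne_of_ne h4 h5, swap_apply_of_ne_of_ne h0 h14]
  obtain ⟨a, b, c, hs, hc⟩ := exists_sees_of_everywhere everywhere_commutator_pow hi hj q.2
  rw [Bool.or_eq_true] at hc
  rcases hc with hc | hc
  · exfalso
    simp only [Bool.and_eq_true, Bool.or_eq_true, decide_eq_true_eq] at hc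
    obtain ⟨rfl, hc⟩ := hc
    have hb : b ≠ void := by
      rintro rfl
      have := q.2
      rw [hs.mid] at this
      exact absurd this (Nat.not_lt_zero _)
    have hm := hs.eq_one hb
    have hq : ∀ p, ∀ hp : p < 63, q.1.2 = p → q = firstBlock hi p hp :=
      fun p hp h => Subtype.ext (Prod.ext hm h)
    rcases hc with ((hc | hc) | hc) | hc
    · exact h0 (hq _ _ hc)
    · exact h4 (hq _ _ hc)
    · exact h5 (hq _ _ hc)
    · exact h14 (hq _ _ hc)
  · apply Subtype.ext
    rw [wordPerm_pow_apply]
    exact iterate_eq_of_closes hs hc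

end Chain

/-! ### Transitivity, generation, degree and fixed points of a chain. -/

namespace Chain

open Block Letter Equiv

instance (i j : ℕ) : Finite (Point i j) := by
  refine Finite.of_injective (β := Fin (i + j + 1) × Fin 64) (fun q =>
    (⟨q.1.1, ?_⟩, ⟨q.1.2, lt_of_lt_of_le q.2 ?_⟩)) ?_
  · by_contra hcon
    have := q.2
    rw [pattern_of_lt (by omega)] at this
    exact absurd this (Nat.not_lt_zero _)
  · unfold pattern; split_ifs <;> simp [size]
  · intro q q' h
    simp only [Prod.mk.injEq, Fin.mk.injEq] at h
    exact Subtype.ext (Prod.ext h.1 h.2)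

noncomputable instance (i j : ℕ) : Fintype (Point i j) := Fintype.ofFinite _

theorem isPretransitive_closure {i j : ℕ} (hi : 2 ≤ i) (hj : 2 ≤ j) :
    MulAction.IsPretransitive
      (Subgroup.closure {letterPerm hi hj rev, letterPerm hi hj turn}) (Point i j) := by
  set H := Subgroup.closure {letterPerm hi hj rev, letterPerm hi hj turn} with hH
  rw [MulAction.isPretransitive_iff_base (firstBlock hi 0 (by omega) : Point i j)]
  have key : ∀ m p : ℕ, ∀ hq : p < (pattern i j m).size,
      (⟨(m, p), hq⟩ : Point i j) ∈ MulAction.orbit H (firstBlock hi 0 (by omega) : Point i j) := by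
    intro m
    induction m using Nat.strong_induction_on with
    | _ m ihm =>
    intro p
    induction p using Nat.strong_induction_on with
    | _ p ihp =>
    intro hq
    obtain ⟨a, b, c, hs, hc⟩ := exists_sees_of_everywhere everywhere_descent hi hj hq
    simp only [Bool.or_eq_true, Bool.and_eq_true, decide_eq_true_eq, List.any_eq_true] at hc
    rcases hc with ⟨rfl, rfl⟩ | ⟨l, -, hl⟩
    · have hb : b ≠ void := by
        rintro rfl
        rw [hs.mid] at hq
        exact absurd hq (Nat.not_lt_zero _)
      obtain rfl := hs.eq_one hb
      exact MulAction.mem_orbit_self _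
    · have hmem : actPoint hi hj l ⟨(m, p), hq⟩ ∈
          MulAction.orbit H (firstBlock hi 0 (by omega) : Point i j) := by
        obtain ⟨a', b', c', hs', hc'⟩ := exists_sees_of_everywhere (everywhere_lt_size l) hi hj hq
        obtain ⟨-, rfl, rfl, rfl, -⟩ := hs'
        obtain ⟨-, rfl, rfl, rfl, -⟩ := id hs
        rw [decide_eq_true_eq] at hc'
        set r := act (window (pattern i j (m - 1)) (pattern i j m) (pattern i j (m + 1))) l (2, p)
          with hr
        have hu : window (pattern i j (m - 1)) (pattern i j m) (pattern i j (m + 1)) r.1 ≠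
            unknown := by
          intro h
          rw [h] at hc'
          exact absurd hc' (Nat.not_lt_zero _)
        have hact := act_shift hs l (2, p) hu
        rw [shift_two, ← hr] at hact
        have hpos := hs.pos
        have hval : actPoint hi hj l ⟨(m, p), hq⟩ =
            ⟨shift m r, hact ▸ act_lt_size hi hj l ⟨(m, p), hq⟩⟩ := Subtype.ext hact
        rw [hval]
        -- The image lies in the preceding block (outer induction) or has a smaller number in the
        -- same block (inner induction).
        rcases hl with hl | ⟨hl, hl'⟩
        · exact ihm (r.1 + m - 2) (by omega) r.2 _
        · have e : shift m r = (m, r.2) := by rw [shift, hl]; simp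
          have := ihp r.2 hl' (by
            have := act_lt_size hi hj l ⟨(m, p), hq⟩
            rw [hact, e] at this
            exact this)
          convert this using 2
      have h2 : (⟨letterPerm hi hj l, letterPerm_mem hi hj l⟩ : H) • (⟨(m, p), hq⟩ : Point i j) =
          actPoint hi hj l ⟨(m, p), hq⟩ := by
        cases l <;> rfl
      rw [← h2] at hmem
      have := MulAction.mem_orbit_of_mem_orbit
        (⟨letterPerm hi hj l, letterPerm_mem hi hj l⟩ : H)⁻¹ hmem
      rwa [inv_smul_smul] at this
  rintro ⟨⟨m, p⟩, hq⟩
  exact key m p hq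

theorem alternatingGroup_le_closure {i j : ℕ} (hi : 2 ≤ i) (hj : 2 ≤ j) :
    alternatingGroup (Point i j) ≤
      Subgroup.closure {letterPerm hi hj rev, letterPerm hi hj turn} := by
  have hinj : Function.Injective (fun p : Fin 63 => (firstBlock hi p.1 p.2 : Point i j)) :=
    fun p p' h => Fin.ext (congrArg (fun q : Point i j => q.1.2) h)
  -- Here `z`, `a`, `x`, `y` are the points 0, 14, 4, 5 of the first block. Conjugation by the word
  -- `g` keeps 0 and sends 14, 4, 5 to 23, 9, 11. The word for `h` fixes 0 and takes 14 to 59 in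
  -- nine steps and to 53 in four, while `turn` maps 59 to 53.
  refine alternatingGroup_le_closure_pair (isPretransitive_closure hi hj)
    (pow_mem (wordPerm_mem hi hj _) 213486) (wordPerm_mem hi hj [turn, rev, turnInv])
    (wordPerm_mem hi hj [rev, turn, rev, turnInv]) (x' := firstBlock hi 9 (by omega))
    (y' := firstBlock hi 11 (by omega)) (b := firstBlock hi 23 (by omega)) ?_
    (commutator_pow_eq hi hj)
    (wordPerm_firstBlock hi hj _ _ (by decide +kernel))
    (wordPerm_firstBlock hi hj _ _ (by decide +kernel))
    (wordPerm_firstBlock hi hj _ _ (by decide +kernel))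
    (wordPerm_firstBlock hi hj _ _ (by decide +kernel))
    (wordPerm_firstBlock hi hj (w := [rev]) _ _ (by decide +kernel))
    (wordPerm_firstBlock hi hj _ _ (by decide +kernel)) (k := 9) (l := 4) ?_
  · exact List.Nodup.map hinj (by decide : ([0, 14, 23, 4, 5, 9, 11] : List (Fin 63)).Nodup)
  · rw [wordPerm_pow_firstBlock hi hj (p' := 59) _ (by omega) (by decide +kernel),
      wordPerm_pow_firstBlock hi hj (p' := 53) _ (by omega) (by decide +kernel)]
    exact wordPerm_firstBlock hi hj (w := [turn]) _ _ (by decide +kernel)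

/-- Counting the points of a chain with a given property block by block. -/
theorem card_subtype_point (i j : ℕ) (P : ℕ × ℕ → Prop) [DecidablePred P] :
    Nat.card {q : Point i j // P q.1} = ∑ m ∈ Finset.range (i + j),
      ((Finset.range (pattern i j (m + 1)).size).filter fun p => P (m + 1, p)).card := by
  rw [← Finset.card_sigma, ← Nat.card_eq_finsetCard]
  refine Nat.card_congr
    ⟨fun q => ⟨⟨q.1.1.1 - 1, q.1.1.2⟩, ?_⟩, fun r => ⟨⟨(r.1.1 + 1, r.1.2), ?_⟩, ?_⟩, ?_, ?_⟩
  · obtain ⟨⟨⟨m, p⟩, hq⟩, hP⟩ := q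
    have hm : 1 ≤ m ∧ m ≤ i + j := by
      by_contra hcon
      have : pattern i j m = void := by unfold pattern; split_ifs <;> first | rfl | omega
      change p < (pattern i j m).size at hq
      rw [this] at hq
      exact absurd hq (Nat.not_lt_zero p)
    simp only [Finset.mem_sigma, Finset.mem_range, Finset.mem_filter]
    rw [Nat.sub_add_cancel hm.1]
    exact ⟨by omega, hq, hP⟩
  · have := r.2
    simp only [Finset.mem_sigma, Finset.mem_range, Finset.mem_filter] at this
    exact this.2.1
  · have := r.2
    simp only [Finset.mem_sigma, Finset.mem_range, Finset.mem_filter] at this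
    exact this.2.2
  · rintro ⟨⟨⟨m, p⟩, hq⟩, hP⟩
    have hm : 1 ≤ m := by
      by_contra hcon
      obtain rfl : m = 0 := by omega
      exact absurd hq (Nat.not_lt_zero p)
    simp only [Subtype.mk.injEq, Prod.mk.injEq, and_true]
    omega
  · rintro ⟨⟨m, p⟩, h⟩
    rfl

theorem card_point (i j : ℕ) : Nat.card (Point i j) = 63 * i + 64 * j := by
  have h := card_subtype_point i j (fun _ => True)
  rw [Nat.card_congr (Equiv.subtypeUnivEquiv fun _ => trivial)] at h
  rw [h, Finset.sum_range_add, Finset.sum_congr rfl (g := fun _ => 63),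
    Finset.sum_congr (s₁ := Finset.range j) rfl (g := fun _ => 64)]
  · simp [mul_comm]
  · intro m hm
    rw [Finset.mem_range] at hm
    rw [pattern_large (by omega) (by omega)]
    simp [size]
  · intro m hm
    rw [Finset.mem_range] at hm
    rw [pattern_small (by omega) (by omega)]
    simp [size]

theorem Sees.rev_fixed_iff {T : ℕ → Block} {m : ℕ} {a b c : Block} (hs : Sees T m a b c)
    {p : ℕ} (hu : window a b c (act (window a b c) rev (2, p)).1 ≠ unknown) :
    act T rev (m, p) = (m, p) ↔ act (window a b c) rev (2, p) = (2, p) := by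
  have := act_shift hs rev (2, p) hu
  rw [shift_two] at this
  rw [this]
  constructor
  · intro h
    have h1 := congrArg Prod.fst h
    have h2 := congrArg Prod.snd h
    have h3 := hs.pos
    simp only [shift] at h1 h2
    exact Prod.ext (by change _ = 2; omega) h2
  · intro h
    rw [h, shift_two]

/-- The number of fixed points of the involution in the middle block of a window. -/
def fixedCount (a b c : Block) : ℕ :=
  ((List.range b.size).filter fun p => act (window a b c) rev (2, p) = (2, p)).length

theorem Sees.card_rev_fixed {i j : ℕ} (hi : 2 ≤ i) (hj : 2 ≤ j) {m : ℕ} {a b c : Block}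
    (hs : Sees (pattern i j) m a b c) :
    ((Finset.range (pattern i j m).size).filter
      fun p => act (pattern i j) rev (m, p) = (m, p)).card = fixedCount a b c := by
  have : ((Finset.range (pattern i j m).size).filter
      fun p => act (pattern i j) rev (m, p) = (m, p)) =
      (Finset.range b.size).filter fun p => act (window a b c) rev (2, p) = (2, p) := by
    rw [hs.mid]
    refine Finset.filter_congr fun p hp => hs.rev_fixed_iff ?_
    rw [Finset.mem_range] at hp
    obtain ⟨a', b', c', hs', hc'⟩ := exists_sees_of_everywhere (everywhere_lt_size rev) hi hj
      (show p < (pattern i j m).size by rw [hs.mid]; exact hp)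
    obtain ⟨-, rfl, rfl, rfl, -⟩ := hs'
    obtain ⟨-, rfl, rfl, rfl, -⟩ := hs
    intro h
    rw [decide_eq_true_eq, h] at hc'
    exact absurd hc' (Nat.not_lt_zero _)
  rw [this]
  rfl

/-- Each small block has three fixed points of its own and a large block none. The unjoined pairs at
the two ends of the chain contribute the other four. -/
theorem card_rev_fixed {i j : ℕ} (hi : 2 ≤ i) (hj : 2 ≤ j) :
    Nat.card {q : Point i j // letterPerm hi hj rev q = q} = 3 * i + 4 := by
  have h := card_subtype_point i j (fun q => act (pattern i j) rev q = q)
  have hk := pattern_ne_unknown i j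
  have e : Nat.card {q : Point i j // letterPerm hi hj rev q = q} =
      Nat.card {q : Point i j // act (pattern i j) rev q.1 = q.1} :=
    Nat.card_congr (Equiv.subtypeEquivRight fun q => Subtype.ext_iff)
  obtain ⟨i, rfl⟩ : ∃ i', i = i' + 2 := ⟨i - 2, by omega⟩
  obtain ⟨j, rfl⟩ : ∃ j', j = j' + 2 := ⟨j - 2, by omega⟩
  have hmid : ∀ m ∈ Finset.range (i + 1),
      ((Finset.range (pattern (i + 2) (j + 2) (m + 1 + 1)).size).filter
      fun p => act (pattern (i + 2) (j + 2)) rev (m + 1 + 1, p) = (m + 1 + 1, p)).card = 3 := by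
    intro m hm
    rw [Finset.mem_range] at hm
    rcases Nat.eq_or_lt_of_le (show m ≤ i by omega) with h1 | h1
    · have hs : Sees (pattern (i + 2) (j + 2)) (m + 1 + 1) small small large :=
        ⟨by omega, pattern_small (by omega) (by omega), pattern_small (by omega) (by omega),
          pattern_large (by omega) (by omega), hk⟩
      rw [hs.card_rev_fixed hi hj]
      decide +kernel
    · have hs : Sees (pattern (i + 2) (j + 2)) (m + 1 + 1) small small small :=
        ⟨by omega, pattern_small (by omega) (by omega), pattern_small (by omega) (by omega),
          pattern_small (by omega) (by omega), hk⟩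
      rw [hs.card_rev_fixed hi hj]
      decide +kernel
  have hlarge : ∀ m ∈ Finset.range (j + 1),
      ((Finset.range (pattern (i + 2) (j + 2) (i + 2 + m + 1)).size).filter
      fun p => act (pattern (i + 2) (j + 2)) rev (i + 2 + m + 1, p) = (i + 2 + m + 1, p)).card =
        0 := by
    intro m hm
    rw [Finset.mem_range] at hm
    rcases Nat.eq_zero_or_pos m with h1 | h1
    · have hs : Sees (pattern (i + 2) (j + 2)) (i + 2 + m + 1) small large large :=
        ⟨by omega, pattern_small (by omega) (by omega), pattern_large (by omega) (by omega),
          pattern_large (by omega) (by omega), hk⟩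
      rw [hs.card_rev_fixed hi hj]
      decide +kernel
    · have hs : Sees (pattern (i + 2) (j + 2)) (i + 2 + m + 1) large large large :=
        ⟨by omega, pattern_large (by omega) (by omega), pattern_large (by omega) (by omega),
          pattern_large (by omega) (by omega), hk⟩
      rw [hs.card_rev_fixed hi hj]
      decide +kernel
  have hlast : ((Finset.range (pattern (i + 2) (j + 2) (i + 2 + (j + 1) + 1)).size).filter
      fun p => act (pattern (i + 2) (j + 2)) rev (i + 2 + (j + 1) + 1, p) =
        (i + 2 + (j + 1) + 1, p)).card = 2 := by
    have hs : Sees (pattern (i + 2) (j + 2)) (i + 2 + (j + 1) + 1) large large void :=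
      ⟨by omega, pattern_large (by omega) (by omega), pattern_large (by omega) (by omega),
        pattern_of_lt (by omega), hk⟩
    rw [hs.card_rev_fixed hi hj]
    decide +kernel
  have hfirst : ((Finset.range (pattern (i + 2) (j + 2) (0 + 1)).size).filter
      fun p => act (pattern (i + 2) (j + 2)) rev (0 + 1, p) = (0 + 1, p)).card = 5 := by
    rw [(sees_one (j + 2) hi).card_rev_fixed hi hj]
    decide +kernel
  rw [e, h, Finset.sum_range_add, Finset.sum_range_succ', Finset.sum_range_succ _ (j + 1),
    Finset.sum_congr rfl hmid, Finset.sum_congr rfl hlarge, hlast, hfirst]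
  simp
  omega

end Chain

/-! ### Orders of centralizers of involutions. -/

section Centralizer

open Equiv Equiv.Perm

theorem Equiv.Perm.cycleType_of_sq_eq_one {α : Type*} [Fintype α] [DecidableEq α] {s : Perm α}
    (hs : s ^ 2 = 1) : s.cycleType = Multiset.replicate (s.support.card / 2) 2 := by
  have h : s.cycleType = Multiset.replicate s.cycleType.card 2 := by
    rw [Multiset.eq_replicate]
    refine ⟨rfl, fun c hc => ?_⟩
    have h1 := two_le_of_mem_cycleType hc
    have h2 := Nat.le_of_dvd (by norm_num)
      ((dvd_of_mem_cycleType hc).trans (orderOf_dvd_of_pow_eq_one hs))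
    omega
  have h2 := s.sum_cycleType
  rw [h] at h2
  simp only [Multiset.sum_replicate, smul_eq_mul] at h2
  rw [h, ← h2, Nat.mul_div_cancel _ (by norm_num)]

/-- The order of the centralizer of an involution with `e` fixed points and `k` two-cycles. -/
theorem Equiv.Perm.card_centralizer_of_sq_eq_one {α : Type*} [Fintype α] [DecidableEq α]
    {s : Perm α} (hs : s ^ 2 = 1) {e k : ℕ} (he : Nat.card {a : α // s a = a} = e)
    (hk : Fintype.card α = e + 2 * k) (hk0 : 0 < k) :
    Nat.card (Subgroup.centralizer {s}) = e.factorial * 2 ^ k * k.factorial := by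
  have hsupp : s.support.card = 2 * k := by
    have h1 : Fintype.card {a : α // s a = a} + s.support.card = Fintype.card α := by
      rw [Fintype.card_subtype, ← Finset.card_univ, support]
      exact Finset.card_filter_add_card_filter_not (fun a => s a = a)
    rw [Nat.card_eq_fintype_card] at he
    omega
  have hct : s.cycleType = Multiset.replicate k 2 := by
    rw [cycleType_of_sq_eq_one hs, hsupp, Nat.mul_div_cancel_left _ (by norm_num)]
  rw [nat_card_centralizer, hct, Multiset.toFinset_replicate, if_neg hk0.ne']
  simp only [Multiset.sum_replicate, Multiset.prod_replicate, Finset.prod_singleton,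
    Multiset.count_replicate_self, smul_eq_mul]
  congr 3
  omega

/-- Replacing a two-cycle by two fixed points multiplies `e! * 2 ^ k * k!`, with `k` becoming `k -
1`, by `(e + 1) * (e + 2) / (2 * k)`. The hypothesis makes this exceed 2 at the first replacement,
and the factor only grows afterwards. -/
theorem two_mul_factorial_lt {e k d : ℕ} (hd : 0 < d) (h : 4 * (k + d) < (e + 1) * (e + 2)) :
    2 * (e.factorial * 2 ^ (k + d) * (k + d).factorial) <
      (e + 2 * d).factorial * 2 ^ k * k.factorial := by
  have step : ∀ e k : ℕ, 4 * (k + 1) < (e + 1) * (e + 2) →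
      2 * (e.factorial * 2 ^ (k + 1) * (k + 1).factorial) <
        (e + 2).factorial * 2 ^ k * k.factorial := by
    intro e k h
    have h0 : 0 < e.factorial * 2 ^ k * k.factorial := by positivity
    have h1 : 2 * (e.factorial * 2 ^ (k + 1) * (k + 1).factorial) =
        (e.factorial * 2 ^ k * k.factorial) * (4 * (k + 1)) := by
      rw [Nat.factorial_succ, pow_succ]; ring
    have h2 : (e + 2).factorial * 2 ^ k * k.factorial =
        (e.factorial * 2 ^ k * k.factorial) * ((e + 1) * (e + 2)) := by
      rw [Nat.factorial_succ, Nat.factorial_succ]; ring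
    rw [h1, h2]
    exact Nat.mul_lt_mul_of_pos_left h h0
  induction d, hd using Nat.le_induction generalizing k with
  | base => exact step e k h
  | succ d hd ih =>
    have h1 := ih (k := k + 1) (by rw [show k + 1 + d = k + (d + 1) by ring]; exact h)
    have h2 := step (e + 2 * d) k (by nlinarith)
    rw [show k + 1 + d = k + (d + 1) by ring] at h1
    rw [show e + 2 * d + 2 = e + 2 * (d + 1) by ring] at h2
    omega

variable {α : Type*} [Fintype α] [DecidableEq α]

theorem card_centralizer_alternatingGroup_le (y : alternatingGroup α) :
    Nat.card (Subgroup.centralizer {y}) ≤ Nat.card (Subgroup.centralizer {(y : Perm α)}) := by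
  refine Nat.card_le_card_of_injective
    (fun g => ⟨((g : alternatingGroup α) : Perm α), ?_⟩) fun g h hgh => ?_
  · have := g.2
    rw [Subgroup.mem_centralizer_singleton_iff] at this ⊢
    exact congrArg Subtype.val this
  · exact Subtype.ext (Subtype.ext (congrArg (fun k : Subgroup.centralizer _ => (k : Perm α)) hgh))

/-- The even elements of the centralizer are the kernel of the sign, which takes at most two values.
-/
theorem card_centralizer_le_two_mul (y : alternatingGroup α) :
    Nat.card (Subgroup.centralizer {(y : Perm α)}) ≤ 2 * Nat.card (Subgroup.centralizer {y}) := by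
  set C := Subgroup.centralizer {(y : Perm α)}
  have h1 : Nat.card ((alternatingGroup α).subgroupOf C) ≤ Nat.card (Subgroup.centralizer {y}) := by
    refine Nat.card_le_card_of_injective
      (fun g => ⟨⟨((g : C) : Perm α), g.2⟩, ?_⟩) fun g h hgh => ?_
    · have := (g : C).2
      rw [Subgroup.mem_centralizer_singleton_iff] at this ⊢
      exact Subtype.ext this
    · exact Subtype.ext (Subtype.ext
        (congrArg (fun k : Subgroup.centralizer {y} => ((k : alternatingGroup α) : Perm α)) hgh))
  have h2 : ((alternatingGroup α).subgroupOf C).index ≤ 2 := by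
    have : ((alternatingGroup α).subgroupOf C).index = Nat.card (sign.comp C.subtype).range := by
      rw [← Subgroup.index_ker]
      congr 1
    rw [this]
    refine (Nat.card_le_card_of_injective _ Subtype.val_injective).trans ?_
    simp
  rw [← Subgroup.card_mul_index ((alternatingGroup α).subgroupOf C), mul_comm 2]
  exact Nat.mul_le_mul h1 h2

/-- Involutions of an alternating group with different numbers of fixed points, of which the
smaller one is not too small, have centralizers of different orders. -/
theorem card_centralizer_lt {y y' : alternatingGroup α} (hy : y ^ 2 = 1) (hy' : y' ^ 2 = 1)
    {e k d : ℕ} (he : Nat.card {a : α // (y : Perm α) a = a} = e)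
    (he' : Nat.card {a : α // (y' : Perm α) a = a} = e + 2 * d)
    (hk : Fintype.card α = e + 2 * (k + d)) (hk0 : 0 < k) (hd : 0 < d)
    (h : 4 * (k + d) < (e + 1) * (e + 2)) :
    Nat.card (Subgroup.centralizer {y}) < Nat.card (Subgroup.centralizer {y'}) := by
  have h1 := card_centralizer_of_sq_eq_one (s := (y : Perm α)) (congrArg Subtype.val hy) he hk
    (by omega)
  have h2 := card_centralizer_of_sq_eq_one (s := (y' : Perm α)) (congrArg Subtype.val hy') he'
    (show Fintype.card α = e + 2 * d + 2 * k by omega) hk0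
  have h3 := two_mul_factorial_lt hd h
  have h4 := card_centralizer_alternatingGroup_le y
  have h5 := card_centralizer_le_two_mul y'
  rw [h1] at h4
  rw [h2] at h5
  omega

end Centralizer

/-! ### From permutations of a finite set to generators of `A_n`. -/

section Transport

open Equiv Equiv.Perm

/-- A generating pair of the alternating group on `α`, given by permutations `s` and `u`, yields a
generating pair of the alternating group of the same degree. -/
theorem exists_alternatingGroup_pair {α : Type*} [Fintype α] [DecidableEq α] {n : ℕ}
    (hn : Nat.card α = n) {s u : Perm α} (hs : s ^ 2 = 1) (hu : u ^ 3 = 1)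
    (hr : (s * u⁻¹) ^ 7 = 1) (hr' : s * u⁻¹ ≠ 1)
    (hgen : alternatingGroup α ≤ Subgroup.closure {s, u}) :
    ∃ x y : alternatingGroup (Fin n), y ^ 2 = 1 ∧ Subgroup.closure {x, y} = ⊤ ∧
      orderOf x = 7 ∧ orderOf (x⁻¹ * y) = 3 ∧
      Nat.card {a : Fin n // (y : Perm (Fin n)) a = a} = Nat.card {a : α // s a = a} := by
  let e : α ≃ Fin n := Finite.equivFinOfCardEq hn
  let E : Perm α ≃* Perm (Fin n) := e.permCongrHom
  have hE : ∀ g : Perm α, ∀ a, E g a = e (g (e.symm a)) := fun _ _ => rfl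
  have hsign : ∀ g : Perm α, sign (E g) = sign g := fun g => sign_permCongr e g
  -- Elements of odd order are even; this applies to `u` and `s * u⁻¹`, hence also to `s`.
  have heven : ∀ g : Perm α, ∀ m : ℕ, Odd m → g ^ m = 1 → sign g = 1 := by
    intro g m hm hg
    have h1 := congrArg sign hg
    rw [map_pow, map_one] at h1
    rcases Int.units_eq_one_or (sign g) with h | h
    · exact h
    · rw [h, hm.neg_one_pow] at h1
      exact absurd h1 (by decide)
  have hsu : sign u = 1 := heven u 3 (by decide) hu
  have hsr : sign (s * u⁻¹) = 1 := heven _ 7 (by decide) hr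
  have hss : sign s = 1 := by
    rwa [map_mul, map_inv, hsu, inv_one, mul_one] at hsr
  let x : alternatingGroup (Fin n) := ⟨E (s * u⁻¹), by rw [mem_alternatingGroup, hsign, hsr]⟩
  let y : alternatingGroup (Fin n) := ⟨E s, by rw [mem_alternatingGroup, hsign, hss]⟩
  have hx7 : x ^ 7 = 1 := Subtype.ext (by
    change E (s * u⁻¹) ^ 7 = 1; rw [← map_pow, hr, map_one])
  have hx1 : x ≠ 1 := fun h => hr' (by
    have : E (s * u⁻¹) = 1 := congrArg Subtype.val h
    exact (map_eq_one_iff E E.injective).1 this)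
  have hxy : (x⁻¹ * y) = ⟨E u, by rw [mem_alternatingGroup, hsign, hsu]⟩ := Subtype.ext (by
    change (E (s * u⁻¹))⁻¹ * E s = E u
    rw [← map_inv, ← map_mul]; simp)
  have hz3 : (x⁻¹ * y) ^ 3 = 1 := by
    rw [hxy]
    exact Subtype.ext (by change E u ^ 3 = 1; rw [← map_pow, hu, map_one])
  have hy2 : y ^ 2 = 1 := Subtype.ext (by change E s ^ 2 = 1; rw [← map_pow, hs, map_one])
  -- If `x = y`, then `x ^ 2 = 1` and `x ^ 7 = 1` give `x = 1`.
  have hz1 : x⁻¹ * y ≠ 1 := by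
    intro h
    have hxy' : x = y := inv_mul_eq_one.1 h
    apply hx1
    rw [← hxy'] at hy2
    rw [pow_succ x 6, show 6 = 2 * 3 from rfl, pow_mul, hy2, one_pow, one_mul] at hx7
    exact hx7
  have : Fact (Nat.Prime 7) := ⟨by norm_num⟩
  refine ⟨x, y, hy2, ?_, orderOf_eq_prime hx7 hx1, orderOf_eq_prime hz3 hz1, ?_⟩
  · apply Subgroup.map_injective (alternatingGroup (Fin n)).subtype_injective
    rw [MonoidHom.map_closure, Set.image_pair, ← MonoidHom.range_eq_map, Subgroup.range_subtype]
    change Subgroup.closure {E (s * u⁻¹), E s} = _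
    apply le_antisymm
    · rw [Subgroup.closure_le]
      rintro g (rfl | rfl)
      · exact x.2
      · exact y.2
    · intro g hg
      obtain ⟨k, rfl⟩ := E.surjective g
      rw [mem_alternatingGroup, hsign] at hg
      have hk : k ∈ Subgroup.closure {s, u} := hgen (mem_alternatingGroup.2 hg)
      have hle : Subgroup.closure {s, u} ≤
          (Subgroup.closure {E (s * u⁻¹), E s}).comap E.toMonoidHom := by
        rw [Subgroup.closure_le]
        have m1 : E (s * u⁻¹) ∈ Subgroup.closure {E (s * u⁻¹), E s} :=
          Subgroup.subset_closure (by simp)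
        have m2 : E s ∈ Subgroup.closure {E (s * u⁻¹), E s} := Subgroup.subset_closure (by simp)
        rintro f (rfl | rfl)
        · exact m2
        · change E f ∈ Subgroup.closure {E (s * f⁻¹), E s}
          have : E f = (E (s * f⁻¹))⁻¹ * E s := by rw [← map_inv, ← map_mul]; simp
          rw [this]
          exact mul_mem (inv_mem m1) m2
      exact hle hk
  · refine Nat.card_congr (Equiv.subtypeEquiv e.symm fun a => ?_)
    change e (s (e.symm a)) = a ↔ _
    rw [← Equiv.eq_symm_apply]

end Transport

namespace Chain

open Letter

theorem exists_hurwitz_pair {i j n : ℕ} (hi : 2 ≤ i) (hj : 2 ≤ j) (hn : 63 * i + 64 * j = n) :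
    ∃ x y : alternatingGroup (Fin n), y ^ 2 = 1 ∧ Subgroup.closure {x, y} = ⊤ ∧
      orderOf x = 7 ∧ orderOf (x⁻¹ * y) = 3 ∧
      Nat.card {a : Fin n // (y : Equiv.Perm (Fin n)) a = a} = 3 * i + 4 := by
  have hrot : wordPerm hi hj [turnInv, rev] = letterPerm hi hj rev * (letterPerm hi hj turn)⁻¹ :=
    rfl
  rw [← card_rev_fixed hi hj]
  refine exists_alternatingGroup_pair (u := letterPerm hi hj turn)
    ((card_point i j).trans hn) ?_ (wordPerm_pow_eq_one hi hj everywhere_turn_cube) ?_ ?_ (alternatingGroup_le_closure hi hj)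
  · have := wordPerm_pow_eq_one hi hj everywhere_rev_sq
    rw [pow_one] at this
    rw [sq]
    exact this
  · rw [← hrot]
    exact wordPerm_pow_eq_one hi hj everywhere_rot_pow
  · rw [← hrot]
    intro h
    -- The rotation is nontrivial because it moves point 0 of the first block to point 3.
    have h1 := wordPerm_firstBlock hi hj (w := [turnInv, rev]) (p := 0) (p' := 3) (by omega)
      (by omega) (by decide +kernel)
    rw [h] at h1
    exact absurd (congrArg (fun q : Point i j => q.1.2) h1) (show ¬(0 : ℕ) = 3 by omega)

end Chain

/-! ### Many chains of the same degree. -/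

theorem mainTheorem2 :
    ∀ m : ℕ, ∃ N : ℕ, ∀ n : ℕ, N ≤ n →
      (m : ℕ∞) ≤ Set.encard
        {C : (mapGraph (alternatingGroup (Fin n))).ConnectedComponent |
          ∃ M : RegMap (alternatingGroup (Fin n)), M.IsHurwitz ∧
            (mapGraph (alternatingGroup (Fin n))).connectedComponentMk M.toClass = C} := by
  intro m
  refine ⟨127 * (154 + 63 * m), fun n hn => ?_⟩
  -- The equation `63 * i + 64 * j = n` forces `j ≡ n` modulo 63, so consecutive choices of `j`
  -- differ by 63 and those of `i` by 64. The bound on `n` exceeds `127 * j` for all `j` used, which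
  -- gives `j ≤ i`.
  have hblocks : ∀ r : Fin m, ∃ i j : ℕ, j = n % 63 + 63 + 63 * r ∧ 63 * i + 64 * j = n ∧ j ≤ i ∧
      28 ≤ i := by
    intro r
    have hr := r.2
    refine ⟨(n - 64 * (n % 63 + 63 + 63 * r)) / 63, _, rfl, ?_, ?_, ?_⟩ <;> omega
  choose i j hj hn' hji hi using hblocks
  have hpairs := fun r : Fin m => Chain.exists_hurwitz_pair (n := n) (i := i r) (j := j r)
    (by have := hi r; omega) (by have := hj r; omega) (hn' r)
  choose x y hy hgen hx hz hfix using hpairs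
  let M : Fin m → RegMap (alternatingGroup (Fin n)) := fun r =>
    cayleyRegMap (x r) (y r) (hy r) (hgen r)
  have hlt : ∀ r r' : Fin m, r < r' →
      Nat.card (Subgroup.centralizer {y r'}) < Nat.card (Subgroup.centralizer {y r}) := by
    intro r r' h
    have h1 := hj r
    have h2 := hj r'
    have h3 := hn' r
    have h4 := hn' r'
    have h5 := hji r'
    have h6 := hi r'
    have h7 : (r : ℕ) < r' := h
    -- The involution has `30 * i + 32 * j - 2` two-cycles. Each increase of `r` by one turns 192
    -- fixed points into 96 two-cycles.
    refine card_centralizer_lt (hy r') (hy r) (e := 3 * i r' + 4)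
      (k := 30 * i r + 32 * j r - 2) (d := 96 * (r' - r)) (hfix r')
      ((hfix r).trans ?_) ?_ ?_ ?_ ?_
    · omega
    · rw [Fintype.card_fin]; omega
    · omega
    · omega
    · have h8 : 30 * i r + 32 * j r - 2 + 96 * (r' - r : ℕ) = 30 * i r' + 32 * j r' - 2 := by omega
      rw [h8]
      -- From `j ≤ i` there are at most `62 * i` two-cycles, and `4 * 62 * i < 9 * i ^ 2` as soon as
      -- `28 ≤ i`.
      have h9 : 30 * i r' + 32 * j r' - 2 ≤ 62 * i r' := by omega
      nlinarith
  have hinj : Function.Injective fun r : Fin m =>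
      (mapGraph (alternatingGroup (Fin n))).connectedComponentMk (M r).toClass := by
    have hne : ∀ r r' : Fin m, r < r' →
        (mapGraph (alternatingGroup (Fin n))).connectedComponentMk (M r).toClass ≠
          (mapGraph (alternatingGroup (Fin n))).connectedComponentMk (M r').toClass := by
      intro r r' h hC
      have h1 := MapClass.revCentralizerCard_eq_of_reachable
        (SimpleGraph.ConnectedComponent.exact hC)
      rw [revCentralizerCard_cayleyRegMap, revCentralizerCard_cayleyRegMap] at h1
      have h2 : Nat.card (Subgroup.centralizer {y r}) = Nat.card (Subgroup.centralizer {y r'}) :=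
        congrArg ENat.toNat h1
      exact absurd h2 (hlt r r' h).ne'
    intro r r' h
    rcases lt_trichotomy r r' with h1 | h1 | h1
    · exact absurd h (hne r r' h1)
    · exact h1
    · exact absurd h.symm (hne r' r h1)
  calc (m : ℕ∞) = (Set.range fun r : Fin m =>
        (mapGraph (alternatingGroup (Fin n))).connectedComponentMk (M r).toClass).encard := by
        rw [← Set.image_univ, hinj.encard_image, Set.encard_univ]
        simp
    _ ≤ _ := Set.encard_le_encard (by
        rintro _ ⟨r, rfl⟩
        exact ⟨M r, cayleyRegMap_isHurwitz (hy r) (hgen r) (hx r) (hz r), rfl⟩)
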